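/- Let $m,n$ be natural numbers with $m>n+1$ and let $\mathbf A\sim\mathcal W_n(m,\mathbf I_n)$, i.e. $\mathbf A$ is a random $n\times n$ matrix with the law of $\mathbf H^T\mathbf H$, where $\mathbf H\in\mathbb R^{m\times n}$ has independent $\mathcal N(0,1)$ entries. Then almost surely $\mathbf A$ has exactly one factorization $\mathbf A=\mathbf L\mathbf U$ with $\mathbf L=(l_{ij})$ unit lower triangular and $\mathbf U=(u_{ij})$ upper triangular, and its factors have the following distributions. (1) For $1\le i\le n$, $u_{ii}\sim\chi^2_{m-i+1}$. (2) For $1\le i<j\le n$, with $\nu=m-i+1$, $u_{ij}$ has the probability density $$f_{u_{ij}}(z)=\begin{cases}\dfrac{\Gamma\left(\frac{\nu-1}{2}\right)}{2\sqrt{\pi}\,\Gamma\left(\frac{\nu}{2}\right)}, & z=0,\\[2ex] \dfrac{1}{\sqrt{2\pi}\,2^{\frac{\nu}{2}-1}\,\Gamma\left(\frac{\nu}{2}\right)}\,|z|^{\frac{\nu-1}{2}}K_{\frac{\nu-1}{2}}(|z|), & z\ne 0,\end{cases}$$ which is continuous at $0$; here $K_a(y)=\int_0^\infty e^{-y\cosh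 t}\cosh(at)\,dt$ for $y>0$ is the modified Bessel function of the second kind. (3) For $1\le j<i\le n$, $l_{ij}=\frac{1}{\sqrt{m-j+1}}\,t_{ij}$, where $t_{ij}$ has Student's $t$-distribution with $m-j+1$ degrees of freedom. -/

import Mathlib

open MeasureTheory ProbabilityTheory

namespace WishartLU

/-- Real matrices carry the product (Borel) sigma-algebra of their entries. -/
instance instMeasurableSpaceMatrix (n : ℕ) : MeasurableSpace (Matrix (Fin n) (Fin n) ℝ) :=
  inferInstanceAs (MeasurableSpace (Fin n → Fin n → ℝ))

/-- The Wishart distribution `W_n(m, I_n)`: the law of `Hᵀ * H`, where `H` is an `m × n` matrix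
with independent standard normal entries. -/
noncomputable def wishartMeasure (n m : ℕ) : Measure (Matrix (Fin n) (Fin n) ℝ) :=
  (Measure.pi fun _ : Fin m => Measure.pi fun _ : Fin n => gaussianReal 0 1).map
    fun H => (Matrix.of H).transpose * Matrix.of H

/-- The map in `wishartMeasure` is measurable, so that the push-forward is not a junk value. -/
theorem measurable_gram (n m : ℕ) :
    Measurable fun H : Fin m → Fin n → ℝ => (Matrix.of H).transpose * Matrix.of H := by
  refine measurable_pi_lambda _ fun i => measurable_pi_lambda _ fun j => ?_
  simp only [Matrix.mul_apply, Matrix.transpose_apply, Matrix.of_apply]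
  fun_prop

/-- `L` and `U` are the LU factors (Doolittle form) of `A`: `L` is unit lower triangular, `U` is
upper triangular, and `A = L * U`. -/
structure IsLU {n : ℕ} (A L U : Matrix (Fin n) (Fin n) ℝ) : Prop where
  lower_diag : ∀ i, L i i = 1
  lower : ∀ i j, i < j → L i j = 0
  upper : ∀ i j, j < i → U i j = 0
  mul_eq : A = L * U

/-- The chi-squared distribution with `ν` degrees of freedom: the Gamma distribution with shape
`ν / 2` and rate `1 / 2`. -/
noncomputable def chiSquared (ν : ℝ) : Measure ℝ := gammaMeasure (ν / 2) (1 / 2)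

/-- The density of Student's t-distribution with `ν` degrees of freedom. -/
noncomputable def studentTPDF (ν x : ℝ) : ℝ :=
  Real.Gamma ((ν + 1) / 2) / (Real.sqrt (ν * Real.pi) * Real.Gamma (ν / 2)) *
    (1 + x ^ 2 / ν) ^ (-((ν + 1) / 2))

/-- Student's t-distribution with `ν` degrees of freedom. -/
noncomputable def studentT (ν : ℝ) : Measure ℝ :=
  volume.withDensity fun x => ENNReal.ofReal (studentTPDF ν x)

/-- The modified Bessel function of the second kind of order `a`, for an argument `y > 0`:
`K_a(y) = ∫_0^∞ exp (-y cosh t) cosh (a t) dt`. -/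
noncomputable def besselK (a y : ℝ) : ℝ :=
  ∫ t in Set.Ioi (0 : ℝ), Real.exp (-(y * Real.cosh t)) * Real.cosh (a * t)

/-- The density of the off-diagonal entries of `U`. -/
noncomputable def offDiagPDF (ν z : ℝ) : ℝ :=
  if z = 0 then
    Real.Gamma ((ν - 1) / 2) / (2 * Real.sqrt Real.pi * Real.Gamma (ν / 2))
  else
    1 / (Real.sqrt (2 * Real.pi) * (2 : ℝ) ^ (ν / 2 - 1) * Real.Gamma (ν / 2)) *
      |z| ^ ((ν - 1) / 2) * besselK ((ν - 1) / 2) |z|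

end WishartLU

/-! Elimination on a Gram matrix is Gram–Schmidt. Let `h_i` be the columns of `H` and `g_i` the
unnormalized Gram–Schmidt vectors. Expanding each `h_i` in the orthogonal family `g` gives `HᵀH =
LU` with `l_ij = ⟪g_j, h_i⟫ / ‖g_j‖²` and `u_ij = ⟪g_i, h_j⟫` (`isLU_gram`); in particular `u_ii =
‖g_i‖²`.

With indices from zero, `g_i` is the projection of `h_i` onto the orthogonal complement of the span
of the `i` earlier columns. This complement is independent of `h_i` and almost surely has dimension
`m - i`, so `‖g_i‖²` is chi-squared with `m - i` degrees of freedom. For `i < j` the column `h_j` is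
independent of `g_i`, so the pair `(‖g_i‖², ⟪g_i, h_j⟫)` has the law of `(s, √s z)` with `s`
chi-squared and `z` an independent standard normal (`map_gramSchmidt_inner`). Hence `u_ij` is
distributed as `√s z` and `l_ji` as `z / √s`. Both are Gaussian scale mixtures
(`map_mul_prod_gaussianReal`), whose densities are a Bessel and a gamma integral.

If `det A ≠ 0`, all pivots are nonzero and any LU factors are the Schur complement expressions in
`A` (`IsLU.eq_schur`). This gives uniqueness and makes the factors measurable functions of `A`, so
that only the law of `A` matters. -/

namespace WishartLU

open Set Real Filter Topology
open scoped ENNReal NNReal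

/-! ### The Bessel integral -/

/-- The integral `∫ s in (0, ∞), s ^ (a - 1) * exp (-s / 2 - z ^ 2 / (2 * s))`. -/
noncomputable def besselIntegral (a z : ℝ) : ℝ :=
  ∫ s in Ioi (0 : ℝ), s ^ (a - 1) * exp (-(1 / 2 * s) - z ^ 2 / (2 * s))

theorem integrableOn_rpow_mul_exp {a : ℝ} (ha : 0 < a) :
    IntegrableOn (fun s : ℝ => s ^ (a - 1) * exp (-(1 / 2 * s))) (Ioi 0) := by
  refine (integrableOn_rpow_mul_exp_neg_mul_rpow (s := a - 1) (p := 1) (b := 1 / 2) (by linarith)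
    one_pos (by norm_num)).congr_fun (fun s _ => ?_) measurableSet_Ioi
  simp

theorem measurable_besselIntegrand (a z : ℝ) :
    Measurable fun s : ℝ => s ^ (a - 1) * exp (-(1 / 2 * s) - z ^ 2 / (2 * s)) := by
  fun_prop

theorem norm_besselIntegrand_le (a z : ℝ) {s : ℝ} (hs : 0 < s) :
    ‖s ^ (a - 1) * exp (-(1 / 2 * s) - z ^ 2 / (2 * s))‖ ≤ s ^ (a - 1) * exp (-(1 / 2 * s)) := by
  rw [norm_of_nonneg (by positivity)]
  gcongr
  have : 0 ≤ z ^ 2 / (2 * s) := by positivity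
  linarith

theorem integrableOn_besselIntegrand {a : ℝ} (ha : 0 < a) (z : ℝ) :
    IntegrableOn (fun s : ℝ => s ^ (a - 1) * exp (-(1 / 2 * s) - z ^ 2 / (2 * s))) (Ioi 0) :=
  Integrable.mono' (integrableOn_rpow_mul_exp ha)
    (measurable_besselIntegrand a z).aestronglyMeasurable
    ((ae_restrict_mem measurableSet_Ioi).mono fun _ hs => norm_besselIntegrand_le a z hs)

theorem continuous_besselIntegral {a : ℝ} (ha : 0 < a) : Continuous (besselIntegral a) :=
  continuous_of_dominated (fun z => (measurable_besselIntegrand a z).aestronglyMeasurable)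
    (fun z => (ae_restrict_mem measurableSet_Ioi).mono fun _ hs => norm_besselIntegrand_le a z hs)
    (integrableOn_rpow_mul_exp ha) (ae_of_all _ fun s => by fun_prop)

theorem besselIntegral_zero {a : ℝ} (ha : 0 < a) : besselIntegral a 0 = 2 ^ a * Gamma a := by
  have := integral_rpow_mul_exp_neg_mul_Ioi ha (r := 1 / 2) (by norm_num)
  simpa [besselIntegral] using this

/-- Substituting `s = |z| exp t` turns the exponent into `-|z| cosh t`; folding `t < 0` onto `t > 0`
then produces `2 cosh (a t)`. -/
theorem besselIntegral_eq_besselK {a z : ℝ} (ha : 0 < a) (hz : z ≠ 0) :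
    besselIntegral a z = 2 * (|z| ^ a * besselK a |z|) := by
  have hy : 0 < |z| := abs_pos.2 hz
  set y := |z|
  set g : ℝ → ℝ := fun s => s ^ (a - 1) * exp (-(1 / 2 * s) - z ^ 2 / (2 * s))
  set φ : ℝ → ℝ := fun t => exp (a * t) * exp (-(y * cosh t))
  have himage : (fun t : ℝ => y * exp t) '' univ = Ioi 0 := by
    ext s
    constructor
    · rintro ⟨t, -, rfl⟩
      exact mul_pos hy (exp_pos t)
    · intro hs
      refine ⟨log (s / y), trivial, ?_⟩
      simp only [exp_log (div_pos hs hy)]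
      field_simp
  have hderiv : ∀ t ∈ univ, HasDerivWithinAt (fun t : ℝ => y * exp t) (y * exp t) univ t :=
    fun t _ => ((hasDerivAt_exp t).const_mul y).hasDerivWithinAt
  have hinj : InjOn (fun t : ℝ => y * exp t) univ := fun s _ t _ hst =>
    exp_injective (mul_left_cancel₀ hy.ne' hst)
  have hfun (t : ℝ) : |y * exp t| • g (y * exp t) = y ^ a * φ t := by
    have h1 : (y * exp t) * (y * exp t) ^ (a - 1) = y ^ a * exp (a * t) := by
      rw [mul_comm, ← rpow_add_one (by positivity), sub_add_cancel, mul_rpow hy.le (exp_pos t).le,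
        ← exp_mul, mul_comm t a]
    have h2 : -(1 / 2 * (y * exp t)) - z ^ 2 / (2 * (y * exp t)) = -(y * cosh t) := by
      rw [← sq_abs z, cosh_eq, exp_neg]
      change _ - y ^ 2 / _ = _
      field_simp
      ring
    rw [abs_of_pos (by positivity), smul_eq_mul]
    simp only [g, φ, h2]
    rw [← mul_assoc, h1, mul_assoc]
  have hint : Integrable φ := by
    have := (integrableOn_image_iff_integrableOn_abs_deriv_smul MeasurableSet.univ hderiv hinj
      g).1 (himage ▸ integrableOn_besselIntegrand ha z)
    simp only [hfun, integrableOn_univ] at this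
    exact (integrable_const_mul_iff (IsUnit.mk0 _ (by positivity)) _).1 this
  have hsubst : besselIntegral a z = y ^ a * ∫ t, φ t := by
    have := integral_image_eq_integral_abs_deriv_smul MeasurableSet.univ hderiv hinj g
    rw [himage] at this
    simp only [hfun, Measure.restrict_univ, integral_const_mul] at this
    exact this
  have hneg : IntegrableOn (fun t => φ (-t)) (Ioi 0) := hint.comp_neg.integrableOn
  have hsplit : ∫ t, φ t = 2 * besselK a y := by
    rw [← integral_add_compl (measurableSet_Ioi (a := (0 : ℝ))) hint, compl_Ioi]
    have := integral_comp_neg_Ioi 0 φ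
    rw [neg_zero] at this
    rw [← this, ← integral_add hint.integrableOn hneg, besselK, ← integral_const_mul]
    refine integral_congr_ae (ae_of_all _ fun t => ?_)
    simp only [φ, cosh_neg, cosh_eq (a * t), mul_neg]
    ring
  rw [hsubst, hsplit]
  ring

/-- A single formula for both branches: continuity at `0` becomes dominated convergence. The
condition `1 < ν` makes the integral converge at `z = 0`. -/
theorem offDiagPDF_eq {ν : ℝ} (hν : 1 < ν) (z : ℝ) :
    offDiagPDF ν z = 1 / (√(2 * π) * 2 ^ (ν / 2) * Gamma (ν / 2)) *
      besselIntegral ((ν - 1) / 2) z := by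
  have ha : 0 < (ν - 1) / 2 := by linarith
  have hG : Gamma (ν / 2) ≠ 0 := (Gamma_pos_of_pos (by linarith)).ne'
  unfold offDiagPDF
  split_ifs with hz
  · rw [hz, besselIntegral_zero ha, sub_div, rpow_sub two_pos, sqrt_mul two_pos.le, ← sqrt_eq_rpow]
    have h2 : √2 * √2 = 2 := mul_self_sqrt two_pos.le
    have : (2 : ℝ) ^ (ν / 2) ≠ 0 := by positivity
    field_simp
    linear_combination h2
  · rw [besselIntegral_eq_besselK ha hz, rpow_sub two_pos, rpow_one]
    field_simp

theorem continuousAt_offDiagPDF {ν : ℝ} (hν : 1 < ν) : ContinuousAt (offDiagPDF ν) 0 := by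
  rw [funext (offDiagPDF_eq hν)]
  exact (continuous_const.mul (continuous_besselIntegral (by linarith))).continuousAt

/-! ### Gaussian scale mixtures -/

/-- The density of a centred Gaussian with standard deviation `σ`. -/
noncomputable def scaledGaussianPDF (σ z : ℝ) : ℝ :=
  (√(2 * π))⁻¹ * |σ|⁻¹ * exp (-(z ^ 2 / (2 * σ ^ 2)))

theorem measurable_scaledGaussianPDF :
    Measurable fun p : ℝ × ℝ => scaledGaussianPDF p.1 p.2 := by
  unfold scaledGaussianPDF
  fun_prop

theorem gaussianReal_map_mul {σ : ℝ} (hσ : σ ≠ 0) :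
    (gaussianReal 0 1).map (σ * ·) =
      volume.withDensity fun z => ENNReal.ofReal (scaledGaussianPDF σ z) := by
  rw [gaussianReal_map_const_mul, gaussianReal_of_var_ne_zero]
  · congr 1
    ext z
    simp only [gaussianPDF, gaussianPDFReal, scaledGaussianPDF]
    congr 2
    · rw [← mul_inv, ← sqrt_sq_eq_abs, ← sqrt_mul (by positivity)]
      simp
    · simp [neg_div]
  · simpa [← NNReal.coe_ne_zero] using hσ

theorem lintegral_gammaMeasure {a r : ℝ} {f : ℝ → ℝ≥0∞} (hf : Measurable f) :
    ∫⁻ s, f s ∂gammaMeasure a r =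
      ∫⁻ s in Ioi 0, ENNReal.ofReal (r ^ a / Gamma a * s ^ (a - 1) * exp (-(r * s))) * f s := by
  rw [gammaMeasure, lintegral_withDensity_eq_lintegral_mul _ (f := gammaPDF a r)
    (measurable_gammaPDFReal a r).ennreal_ofReal hf,
    ← lintegral_add_compl _ measurableSet_Iio (A := Iio (0 : ℝ)), compl_Iio,
    setLIntegral_congr Ioi_ae_eq_Ici.symm, setLIntegral_eq_zero, zero_add]
  · refine setLIntegral_congr_fun measurableSet_Ioi fun s hs => ?_
    simp [gammaPDF_of_nonneg (le_of_lt hs)]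
  · exact measurableSet_Iio
  · intro s hs
    simp [gammaPDF_of_neg hs]

theorem ae_pos_gammaMeasure (a r : ℝ) : ∀ᵐ s ∂gammaMeasure a r, 0 < s := by
  have hm : MeasurableSet {s : ℝ | ¬ 0 < s} := measurableSet_Ioi.compl
  rw [ae_iff, ← lintegral_indicator_one hm,
    lintegral_gammaMeasure (measurable_one.indicator hm), setLIntegral_eq_zero measurableSet_Ioi]
  intro s hs
  have : s ∉ {s : ℝ | ¬ 0 < s} := fun h => h hs
  beta_reduce
  rw [indicator_of_notMem this, mul_zero, Pi.zero_apply]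

/-- A scale mixture of centred Gaussians has the mixture of the densities as its density. -/
theorem map_mul_prod_gaussianReal (χ : Measure ℝ) [IsProbabilityMeasure χ] {c : ℝ → ℝ}
    (hc : Measurable c) (hc0 : ∀ᵐ s ∂χ, c s ≠ 0) {p : ℝ → ℝ}
    (hp : ∀ᵐ z, ∫⁻ s, ENNReal.ofReal (scaledGaussianPDF (c s) z) ∂χ = ENNReal.ofReal (p z)) :
    (χ.prod (gaussianReal 0 1)).map (fun q => c q.1 * q.2) =
      volume.withDensity fun z => ENNReal.ofReal (p z) := by
  have hm : Measurable fun q : ℝ × ℝ => c q.1 * q.2 := by fun_prop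
  have hm2 : Measurable fun q : ℝ × ℝ => ENNReal.ofReal (scaledGaussianPDF (c q.1) q.2) :=
    (measurable_scaledGaussianPDF.comp
      ((hc.comp measurable_fst).prodMk measurable_snd)).ennreal_ofReal
  ext B hB
  rw [Measure.map_apply hm hB, Measure.prod_apply (hm hB), withDensity_apply _ hB]
  calc _ = ∫⁻ s, (∫⁻ z in B, ENNReal.ofReal (scaledGaussianPDF (c s) z)) ∂χ := by
        -- For fixed `s` the section is a centred Gaussian law; it has a density because `c s ≠ 0`.
        refine lintegral_congr_ae (hc0.mono fun s hs => ?_)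
        have := congrArg (fun μ => μ B) (gaussianReal_map_mul hs)
        simp only [Measure.map_apply (measurable_const_mul (c s)) hB, withDensity_apply _ hB] at this
        exact this
    _ = ∫⁻ z in B, (∫⁻ s, ENNReal.ofReal (scaledGaussianPDF (c s) z) ∂χ) :=

        lintegral_lintegral_swap
          (f := fun s z => ENNReal.ofReal (scaledGaussianPDF (c s) z)) hm2.aemeasurable
    _ = _ := lintegral_congr_ae (ae_restrict_of_ae hp)

theorem isProbabilityMeasure_chiSquared {ν : ℝ} (hν : 0 < ν) :
    IsProbabilityMeasure (chiSquared ν) :=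
  isProbabilityMeasure_gammaMeasure (by linarith) (by norm_num)

/-- The Gaussian factor `s ^ (-1/2)` lowers the chi-squared exponent `ν / 2 - 1` to `(ν - 1) / 2 -
1`, the one in `besselIntegral`. -/
theorem map_sqrt_mul_eq_offDiag {ν : ℝ} (hν : 1 < ν) :
    ((chiSquared ν).prod (gaussianReal 0 1)).map (fun q => √q.1 * q.2) =
      volume.withDensity fun z => ENNReal.ofReal (offDiagPDF ν z) := by
  have := isProbabilityMeasure_chiSquared (ν := ν) (by linarith)
  have ha : 0 < (ν - 1) / 2 := by linarith
  refine map_mul_prod_gaussianReal (chiSquared ν) continuous_sqrt.measurable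
    ((ae_pos_gammaMeasure _ _).mono fun s hs => (sqrt_pos.2 hs).ne') (ae_of_all _ fun z => ?_)
  have hm : Measurable fun s => scaledGaussianPDF √s z :=
    measurable_scaledGaussianPDF.comp (continuous_sqrt.measurable.prodMk measurable_const)
  have hG : 0 < Gamma (ν / 2) := Gamma_pos_of_pos (by linarith)
  rw [chiSquared, lintegral_gammaMeasure hm.ennreal_ofReal, offDiagPDF_eq hν, besselIntegral,
    ← integral_const_mul, ofReal_integral_eq_lintegral_ofReal
      ((integrableOn_besselIntegrand ha z).const_mul _)
      ((ae_restrict_mem measurableSet_Ioi).mono fun s (hs : 0 < s) => by positivity)]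
  refine setLIntegral_congr_fun measurableSet_Ioi fun s (hs : 0 < s) => ?_
  rw [← ENNReal.ofReal_mul (by positivity)]
  congr 1
  have h1 : s ^ (ν / 2 - 1) = s ^ ((ν - 1) / 2 - 1) * √s := by
    rw [sqrt_eq_rpow, ← rpow_add hs]
    ring_nf
  rw [scaledGaussianPDF, abs_of_nonneg (sqrt_nonneg s), sq_sqrt hs.le, h1,
    sub_eq_add_neg (-(1 / 2 * s)), exp_add,
    one_div, inv_rpow two_pos.le]
  have := sqrt_pos.2 hs
  field_simp

theorem map_sqrt_div_mul_eq_studentT {ν : ℝ} (hν : 0 < ν) :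
    ((chiSquared ν).prod (gaussianReal 0 1)).map (fun q => √(ν / q.1) * q.2) = studentT ν := by
  have := isProbabilityMeasure_chiSquared hν
  have hc : Measurable fun s : ℝ => √(ν / s) := by fun_prop
  refine map_mul_prod_gaussianReal (chiSquared ν) hc ((ae_pos_gammaMeasure _ _).mono fun s hs =>
    (sqrt_pos.2 (div_pos hν hs)).ne') (ae_of_all _ fun z => ?_)
  have hm : Measurable fun s => scaledGaussianPDF √(ν / s) z :=
    measurable_scaledGaussianPDF.comp (hc.prodMk measurable_const)
  have hG : 0 < Gamma (ν / 2) := Gamma_pos_of_pos (by linarith)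
  -- The chi-squared rate `1 / 2` plus `z ^ 2 / (2 * ν)` from the Gaussian of variance `ν / s`: what
  -- remains is a gamma integral of shape `(ν + 1) / 2` and rate `r`.
  set r : ℝ := (1 + z ^ 2 / ν) / 2 with hr
  have hr0 : 0 < r := by positivity
  set C : ℝ := (1 / 2) ^ (ν / 2) / Gamma (ν / 2) * (√(2 * π))⁻¹ * (√ν)⁻¹ with hC
  have hint : IntegrableOn (fun s : ℝ => s ^ ((ν + 1) / 2 - 1) * exp (-(r * s))) (Ioi 0) := by
    refine (integrableOn_rpow_mul_exp_neg_mul_rpow (s := (ν + 1) / 2 - 1) (p := 1) (b := r)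
      (by linarith) one_pos hr0).congr_fun (fun s _ => ?_) measurableSet_Ioi
    simp
  have hval : studentTPDF ν z = ∫ s in Ioi (0 : ℝ), C * (s ^ ((ν + 1) / 2 - 1) * exp (-(r * s))) := by
    rw [integral_const_mul, integral_rpow_mul_exp_neg_mul_Ioi (by linarith) hr0, studentTPDF, hC,
      hr, one_div_div, div_rpow two_pos.le (by positivity), rpow_neg (by positivity),
      sqrt_mul hν.le, sqrt_mul two_pos.le, add_div ν 1 2, rpow_add two_pos, ← sqrt_eq_rpow,
      one_div, inv_rpow two_pos.le]
    have : (1 + z ^ 2 / ν) ^ (ν / 2 + 1 / 2) ≠ 0 := by positivity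
    have : (2 : ℝ) ^ (ν / 2) ≠ 0 := by positivity
    field_simp
  rw [chiSquared, lintegral_gammaMeasure hm.ennreal_ofReal, hval, ofReal_integral_eq_lintegral_ofReal
      (hint.const_mul _)
      ((ae_restrict_mem measurableSet_Ioi).mono fun s (hs : 0 < s) => by positivity)]
  refine setLIntegral_congr_fun measurableSet_Ioi fun s (hs : 0 < s) => ?_
  rw [← ENNReal.ofReal_mul (by positivity)]
  congr 1
  have h1 : s ^ ((ν + 1) / 2 - 1) = s ^ (ν / 2 - 1) * √s := by
    rw [sqrt_eq_rpow, ← rpow_add hs]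
    ring_nf
  have h2 : exp (-(r * s)) = exp (-(1 / 2 * s)) * exp (-(z ^ 2 / (2 * (ν / s)))) := by
    rw [← exp_add, hr]
    congr 1
    field_simp
    ring
  rw [scaledGaussianPDF, abs_of_nonneg (sqrt_nonneg _), sq_sqrt (by positivity), h1, h2, hC,
    sqrt_div hν.le, inv_div]
  ring

end WishartLU

namespace WishartLU

open scoped RealInnerProductSpace
open Finset InnerProductSpace

/-! ### Gaussian elimination -/

/-- The successive Schur complements produced by Gaussian elimination without pivoting. -/
noncomputable def schur {n : ℕ} (A : Matrix (Fin n) (Fin n) ℝ) : ℕ → Matrix (Fin n) (Fin n) ℝ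
  | 0 => A
  | k + 1 => Matrix.of fun i j =>
      if h : k < n then
        schur A k i j - schur A k i ⟨k, h⟩ * schur A k ⟨k, h⟩ j / schur A k ⟨k, h⟩ ⟨k, h⟩
      else 0

theorem measurable_schur {n : ℕ} (k : ℕ) (i j : Fin n) :
    Measurable fun A : Matrix (Fin n) (Fin n) ℝ => schur A k i j := by
  induction k generalizing i j with
  | zero =>
    exact (measurable_pi_apply j).comp (measurable_pi_apply (X := fun _ : Fin n => Fin n → ℝ) i)
  | succ k ih =>
    simp only [schur, Matrix.of_apply]
    split_ifs with h
    · exact (ih i j).sub (((ih i _).mul (ih _ j)).div (ih _ _))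
    · exact measurable_const

variable {n : ℕ} {A L U : Matrix (Fin n) (Fin n) ℝ}

/-- `L * U` is a sum of rank-one terms, column `l` of `L` times row `l` of `U`. By triangularity the
`k`-th row and column of the remainder come from term `k` alone, so an elimination step removes
exactly that term. -/
theorem IsLU.schur_eq_sum (h : IsLU A L U) (hU : ∀ k, U k k ≠ 0) {k : ℕ} (hk : k ≤ n)
    (i j : Fin n) : schur A k i j = ∑ l with k ≤ l.val, L i l * U l j := by
  induction k generalizing i j with
  | zero => simp [schur, h.mul_eq, Matrix.mul_apply]
  | succ k ih =>
    have hkn : k < n := hk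
    have split (i j : Fin n) : ∑ l with k ≤ l.val, L i l * U l j =
        L i ⟨k, hkn⟩ * U ⟨k, hkn⟩ j + ∑ l with k + 1 ≤ l.val, L i l * U l j := by
      have : (univ.filter fun l : Fin n => k ≤ l.val) =
          insert ⟨k, hkn⟩ (univ.filter fun l : Fin n => k + 1 ≤ l.val) := by
        ext l
        simp only [mem_filter, mem_univ, true_and, mem_insert, Fin.ext_iff]
        omega
      rw [this, sum_insert (by simp)]
    have row (j : Fin n) : schur A k ⟨k, hkn⟩ j = U ⟨k, hkn⟩ j := by
      rw [ih hkn.le, split, h.lower_diag, one_mul, sum_eq_zero, add_zero]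
      intro l hl
      rw [h.lower _ _ (Fin.lt_def.2 (by simpa using hl)), zero_mul]
    have col (i : Fin n) : schur A k i ⟨k, hkn⟩ = L i ⟨k, hkn⟩ * U ⟨k, hkn⟩ ⟨k, hkn⟩ := by
      rw [ih hkn.le, split, sum_eq_zero, add_zero]
      intro l hl
      rw [h.upper _ _ (Fin.lt_def.2 (by simpa using hl)), mul_zero]
    simp only [schur, Matrix.of_apply, dif_pos hkn]
    rw [row, row, col, ih hkn.le, split]
    field_simp [hU ⟨k, hkn⟩]
    ring

theorem IsLU.upper_eq_schur (h : IsLU A L U) (hU : ∀ k, U k k ≠ 0) (i j : Fin n) :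
    U i j = schur A i i j := by
  rw [h.schur_eq_sum hU i.2.le, sum_eq_single i]
  · rw [h.lower_diag, one_mul]
  · intro l hl hli
    rw [h.lower _ _ (lt_of_le_of_ne (Fin.le_def.2 (by simpa using hl)) hli.symm), zero_mul]
  · simp

theorem IsLU.lower_eq_schur (h : IsLU A L U) (hU : ∀ k, U k k ≠ 0) (i j : Fin n) :
    L i j = schur A j i j / schur A j j j := by
  rw [← h.upper_eq_schur hU, h.schur_eq_sum hU j.2.le, sum_eq_single j]
  · field_simp [hU j]
  · intro l hl hlj
    rw [h.upper _ _ (lt_of_le_of_ne (Fin.le_def.2 (by simpa using hl)) hlj.symm), mul_zero]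
  · simp

theorem IsLU.det_eq (h : IsLU A L U) : A.det = ∏ i, U i i := by
  rw [h.mul_eq, Matrix.det_mul, Matrix.det_of_isLowerTriangular L fun i j hij => h.lower i j hij,
    Matrix.det_of_isUpperTriangular fun i j hij => h.upper i j hij]
  simp [h.lower_diag]

theorem IsLU.diag_ne_zero (h : IsLU A L U) (hA : A.det ≠ 0) (k : Fin n) : U k k ≠ 0 := by
  rw [h.det_eq] at hA
  exact prod_ne_zero_iff.1 hA k (mem_univ k)

theorem IsLU.existsUnique (h : IsLU A L U) (hA : A.det ≠ 0) :
    ∃! F : Matrix (Fin n) (Fin n) ℝ × Matrix (Fin n) (Fin n) ℝ, IsLU A F.1 F.2 := by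
  refine ⟨(L, U), h, fun F hF => Prod.ext ?_ ?_⟩
  · ext i j
    change F.1 i j = L i j
    rw [hF.lower_eq_schur (hF.diag_ne_zero hA), h.lower_eq_schur (h.diag_ne_zero hA)]
  · ext i j
    change F.2 i j = U i j
    rw [hF.upper_eq_schur (hF.diag_ne_zero hA), h.upper_eq_schur (h.diag_ne_zero hA)]

/-! ### Gram matrices and the Gram–Schmidt process -/

variable {E : Type*} [NormedAddCommGroup E] [InnerProductSpace ℝ E]

theorem inner_gramSchmidt_self (h : Fin n → E) (i : Fin n) :
    ⟪gramSchmidt ℝ h i, h i⟫ = ‖gramSchmidt ℝ h i‖ ^ 2 := by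
  rw [congrArg (inner ℝ (gramSchmidt ℝ h i)) (gramSchmidt_def'' ℝ h i), inner_add_right,
    real_inner_self_eq_norm_sq, inner_sum, sum_eq_zero, add_zero]
  intro k hk
  rw [inner_smul_right, gramSchmidt_orthogonal ℝ h (mem_Iio.1 hk).ne', mul_zero]

/-- The Gram–Schmidt process gives the LU factors of a Gram matrix. -/
theorem isLU_gram (h : Fin n → E) (h0 : ∀ i, gramSchmidt ℝ h i ≠ 0) :
    IsLU (Matrix.of fun i j => ⟪h i, h j⟫)
      (Matrix.of fun i j => ⟪gramSchmidt ℝ h j, h i⟫ / ‖gramSchmidt ℝ h j‖ ^ 2)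
      (Matrix.of fun i j => ⟪gramSchmidt ℝ h i, h j⟫) where
  lower_diag i := by
    have := norm_ne_zero_iff.2 (h0 i)
    simp [inner_gramSchmidt_self, this]
  lower i j hij := by simp [gramSchmidt_inv_triangular ℝ h hij]
  upper i j hij := by simp [gramSchmidt_inv_triangular ℝ h hij]
  mul_eq := by
    ext i j
    simp only [Matrix.mul_apply, Matrix.of_apply]
    -- Expansion in the orthogonal family: the coefficient of `gramSchmidt ℝ h i` is `1` and those
    -- of later vectors vanish.
    have key : h i = ∑ k, (⟪gramSchmidt ℝ h k, h i⟫ / ‖gramSchmidt ℝ h k‖ ^ 2) •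
        gramSchmidt ℝ h k := by
      have hI : univ.filter (fun k => k ≤ i) = insert i (Iio i) := by
        ext k; simp [le_iff_eq_or_lt]
      rw [← sum_subset (filter_subset (fun k => k ≤ i) univ), hI, sum_insert (by simp),
        inner_gramSchmidt_self, div_self (pow_ne_zero 2 (norm_ne_zero_iff.2 (h0 i))), one_smul]
      · exact gramSchmidt_def'' ℝ h i
      · intro k _ hk
        rw [gramSchmidt_inv_triangular ℝ h (by simpa using hk), zero_div, zero_smul]
    nth_rewrite 1 [key]
    simp only [sum_inner, real_inner_smul_left]

theorem det_gram_ne_zero (h : Fin n → E) (h0 : ∀ i, gramSchmidt ℝ h i ≠ 0) :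
    (Matrix.of fun i j => ⟪h i, h j⟫).det ≠ 0 := by
  rw [(isLU_gram h h0).det_eq, prod_ne_zero_iff]
  intro i _
  simpa [inner_gramSchmidt_self] using h0 i

/-- In this form the earlier vectors enter only through their span, and the later ones not at all,
so the effect of replacing one vector is immediate. -/
theorem gramSchmidt_eq_starProjection [FiniteDimensional ℝ E] (h : Fin n → E) (i : Fin n) :
    gramSchmidt ℝ h i = (Submodule.span ℝ (h '' Set.Iio i))ᗮ.starProjection (h i) := by
  symm
  apply Submodule.eq_starProjection_of_mem_of_inner_eq_zero
  · rw [Submodule.mem_orthogonal']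
    intro v hv
    induction hv using Submodule.span_induction with
    | mem x hx =>
      obtain ⟨k, hk, rfl⟩ := hx
      exact gramSchmidt_inv_triangular ℝ h hk
    | zero => simp
    | add x y _ _ hx hy => rw [inner_add_right, hx, hy, add_zero]
    | smul c x _ hx => rw [inner_smul_right, hx, mul_zero]
  · intro w hw
    refine (Submodule.mem_orthogonal _ w).1 hw _ ?_
    rw [← span_gramSchmidt_Iio ℝ h i]
    nth_rewrite 1 [gramSchmidt_def'' ℝ h i]
    rw [add_sub_cancel_left]
    exact Submodule.sum_mem _ fun k hk => Submodule.smul_mem _ _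
      (Submodule.subset_span ⟨k, mem_Iio.1 hk, rfl⟩)

theorem gramSchmidt_update_of_lt [FiniteDimensional ℝ E] (h : Fin n → E) {i j : Fin n} (hij : i < j)
    (x : E) : gramSchmidt ℝ (Function.update h j x) i = gramSchmidt ℝ h i := by
  have : Function.update h j x '' Set.Iio i = h '' Set.Iio i :=
    Set.image_congr fun k hk => Function.update_of_ne (lt_trans hk hij).ne _ _
  rw [gramSchmidt_eq_starProjection, gramSchmidt_eq_starProjection, this,
    Function.update_of_ne hij.ne]

theorem gramSchmidt_update_self [FiniteDimensional ℝ E] (h : Fin n → E) (i : Fin n) (x : E) :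
    gramSchmidt ℝ (Function.update h i x) i =
      (Submodule.span ℝ (h '' Set.Iio i))ᗮ.starProjection x := by
  have : Function.update h i x '' Set.Iio i = h '' Set.Iio i :=
    Set.image_congr fun k hk => Function.update_of_ne (ne_of_lt hk) _ _
  rw [gramSchmidt_eq_starProjection, this, Function.update_self]

theorem finrank_span_image_Iio_le (h : Fin n → E) (i : Fin n) :
    Module.finrank ℝ (Submodule.span ℝ (h '' Set.Iio i)) ≤ i := by
  classical
  have := finrank_span_finset_le_card (R := ℝ) ((Iio i).image h)
  rw [coe_image, coe_Iio] at this
  exact this.trans (card_image_le.trans (by simp))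

theorem finrank_span_image_Iio (h : Fin n → E) (h0 : ∀ i, gramSchmidt ℝ h i ≠ 0) (i : Fin n) :
    Module.finrank ℝ (Submodule.span ℝ (h '' Set.Iio i)) = i := by
  have li : LinearIndependent ℝ (gramSchmidt ℝ h) :=
    linearIndependent_of_ne_zero_of_inner_eq_zero h0 fun _ _ => gramSchmidt_orthogonal ℝ h
  have := finrank_span_eq_card (li.comp ((↑) : Set.Iio i → Fin n) Subtype.coe_injective)
  rw [Set.range_comp, Subtype.range_coe, span_gramSchmidt_Iio] at this
  rw [this, ← Set.toFinset_card]
  simp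

/-- Valid for every `h`, degenerate or not, hence usable to prove that the Gram–Schmidt vectors are
almost surely nonzero. -/
theorem finrank_orthogonal_span_pos [FiniteDimensional ℝ E] (hn : n ≤ Module.finrank ℝ E)
    (h : Fin n → E) (i : Fin n) :
    0 < Module.finrank ℝ (Submodule.span ℝ (h '' Set.Iio i))ᗮ := by
  have h1 := finrank_span_image_Iio_le h i
  have h2 := Submodule.finrank_add_finrank_orthogonal (Submodule.span ℝ (h '' Set.Iio i))
  have := i.2
  omega

theorem measurable_gramSchmidt [FiniteDimensional ℝ E] [MeasurableSpace E] [BorelSpace E]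
    (i : Fin n) : Measurable fun h : Fin n → E => gramSchmidt ℝ h i := by
  induction i using WellFoundedLT.induction with
  | _ i ih =>
    simp_rw [gramSchmidt_def ℝ _ i, Submodule.starProjection_singleton]
    refine (measurable_pi_apply i).sub (Finset.measurable_sum _ fun k hk => ?_)
    have := ih k (mem_Iio.1 hk)
    simp only [RCLike.ofReal_real_eq_id, id]
    exact ((this.inner (measurable_pi_apply i)).div (this.norm.pow_const 2)).smul this

end WishartLU

namespace WishartLU

open Set Real Filter Topology
open scoped ENNReal NNReal RealInnerProductSpace
open InnerProductSpace

/-! ### The squared norm of a standard Gaussian vector -/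

/-- Valid for all `t`: when `t ≥ 1 / 2` the integral diverges and both sides are `0` by convention.
The comparison of moment generating functions below needs equality everywhere. -/
theorem integral_exp_mul_sq_gaussianReal (t : ℝ) :
    ∫ x, exp (t * x ^ 2) ∂gaussianReal 0 1 = √(1 / 2 / (1 / 2 - t)) := by
  rw [integral_gaussianReal_eq_integral_smul one_ne_zero]
  have : ∀ x : ℝ, gaussianPDFReal 0 1 x • exp (t * x ^ 2) =
      (√(2 * π))⁻¹ * exp (-(1 / 2 - t) * x ^ 2) := by
    intro x
    rw [gaussianPDFReal, smul_eq_mul, mul_assoc, ← exp_add]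
    simp only [NNReal.coe_one, mul_one, sub_zero]
    congr 2
    ring
  simp_rw [this]
  rw [integral_const_mul, integral_gaussian, ← sqrt_inv, ← sqrt_mul (by positivity)]
  congr 1
  field_simp

variable {E : Type*} [NormedAddCommGroup E] [InnerProductSpace ℝ E] [FiniteDimensional ℝ E]
  [MeasurableSpace E] [BorelSpace E]

theorem mgf_norm_sq_stdGaussian (t : ℝ) :
    mgf (fun x : E => ‖x‖ ^ 2) (stdGaussian E) t =
      √(1 / 2 / (1 / 2 - t)) ^ Module.finrank ℝ E := by
  set b := stdOrthonormalBasis ℝ E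
  rw [mgf, stdGaussian_eq_map_pi_orthonormalBasis b,
    integral_map (Measurable.aemeasurable (by fun_prop)) (by fun_prop)]
  have : ∀ x : Fin (Module.finrank ℝ E) → ℝ,
      exp (t * ‖∑ i, x i • b i‖ ^ 2) = ∏ i, exp (t * x i ^ 2) := by
    intro x
    rw [← exp_sum, ← Finset.mul_sum, ← b.sum_sq_norm_inner_right]
    simp [b.orthonormal.inner_right_fintype]
  simp_rw [this]
  rw [integral_fintype_prod_eq_prod (f := fun _ x => exp (t * x ^ 2))]
  simp_rw [integral_exp_mul_sq_gaussianReal]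
  rw [Finset.prod_const, Finset.card_univ, Fintype.card_fin]

theorem mgf_chiSquared {k : ℕ} (hk : 0 < k) (t : ℝ) :
    mgf id (chiSquared k) t = √(1 / 2 / (1 / 2 - t)) ^ k := by
  have hk' : (0 : ℝ) < k / 2 := by positivity
  have hG := Gamma_pos_of_pos hk'
  set C : ℝ := (1 / 2) ^ ((k : ℝ) / 2) / Gamma (k / 2) with hC
  have hint : mgf id (chiSquared k) t =
      C * ∫ s in Ioi (0 : ℝ), s ^ ((k : ℝ) / 2 - 1) * exp (-((1 / 2 - t) * s)) := by
    have hpdf : gammaPDF (k / 2) (1 / 2) = fun s => ENNReal.ofReal (gammaPDFReal (k / 2) (1 / 2) s) :=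
      rfl
    rw [mgf, chiSquared, gammaMeasure, hpdf, integral_withDensity_eq_integral_toReal_smul
      (measurable_gammaPDFReal _ _).ennreal_ofReal (ae_of_all _ fun _ => ENNReal.ofReal_lt_top),
      ← integral_const_mul, ← integral_Ici_eq_integral_Ioi, ← integral_indicator measurableSet_Ici]
    refine integral_congr_ae (ae_of_all _ fun s => ?_)
    simp only [id, smul_eq_mul,
      ENNReal.toReal_ofReal (gammaPDFReal_nonneg hk' (by norm_num : (0 : ℝ) < 1 / 2) s)]
    by_cases hs : 0 ≤ s
    · rw [indicator_of_mem (mem_Ici.2 hs), gammaPDFReal, if_pos hs, mul_assoc, ← exp_add, mul_assoc, hC]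
      ring_nf
    · rw [indicator_of_notMem (notMem_Ici.2 (not_le.1 hs)), gammaPDFReal, if_neg hs, zero_mul]
  rw [hint]
  rcases lt_or_ge t (1 / 2) with ht | ht
  · have hr : 0 < 1 / 2 - t := sub_pos.2 ht
    rw [integral_rpow_mul_exp_neg_mul_Ioi hk' hr, hC, sqrt_eq_rpow, ← rpow_mul_natCast (by positivity),
      div_eq_mul_one_div (1 / 2 : ℝ) (1 / 2 - t), mul_rpow (by norm_num) (by positivity)]
    field_simp
  · have hneg : 1 / 2 / (1 / 2 - t) ≤ 0 := div_nonpos_of_nonneg_of_nonpos (by norm_num) (by linarith)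
    rw [sqrt_eq_zero_of_nonpos hneg, zero_pow hk.ne', integral_undef, mul_zero]
    intro hi
    -- For `t ≥ 1 / 2` the exponential is at least `1`, so integrability would pass to a pure power
    -- on the half-line.
    refine not_integrableOn_Ioi_rpow ((k : ℝ) / 2 - 1) (Integrable.mono' hi (by fun_prop) ?_)
    refine (ae_restrict_mem measurableSet_Ioi).mono fun s (hs : 0 < s) => ?_
    rw [norm_of_nonneg (by positivity)]
    refine le_mul_of_one_le_right (by positivity) (one_le_exp ?_)
    nlinarith

/-- The moment generating functions agree and are finite near `0`; analytic continuation to the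
imaginary axis identifies the characteristic functions. -/
theorem map_norm_sq_stdGaussian (hE : 0 < Module.finrank ℝ E) :
    (stdGaussian E).map (fun x => ‖x‖ ^ 2) = chiSquared (Module.finrank ℝ E) := by
  have := isProbabilityMeasure_chiSquared (ν := Module.finrank ℝ E) (by exact_mod_cast hE)
  have hmgf : mgf (fun x : E => ‖x‖ ^ 2) (stdGaussian E) =
      mgf id (chiSquared (Module.finrank ℝ E)) := by
    ext t
    rw [mgf_norm_sq_stdGaussian, mgf_chiSquared hE]
  have h0 : (0 : ℝ) ∈ interior (integrableExpSet (fun x : E => ‖x‖ ^ 2) (stdGaussian E)) := by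
    refine mem_interior.2 ⟨Iio (1 / 2), fun t ht => ?_, isOpen_Iio, by norm_num⟩
    -- A positive value certifies integrability, since a divergent integral would be `0`.
    have h : 0 < mgf (fun x : E => ‖x‖ ^ 2) (stdGaussian E) t := by
      rw [mgf_norm_sq_stdGaussian]
      have : 0 < 1 / 2 - t := sub_pos.2 ht
      positivity
    exact mgf_pos_iff.1 h
  have hm : Measurable fun x : E => ‖x‖ ^ 2 := by fun_prop
  have := Measure.isProbabilityMeasure_map hm.aemeasurable (μ := stdGaussian E)
  refine Measure.ext_of_charFun (funext fun t => ?_)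
  have := eqOn_complexMGF_of_mgf hmgf (x := t * Complex.I) (by simpa using h0)
  rw [complexMGF_mul_I hm.aemeasurable, complexMGF_mul_I aemeasurable_id, Measure.map_id] at this
  exact this

/-- For `t ∈ V`, pairing the projection of `x` with `t` is pairing `x` itself with `t`, so the
characteristic functions coincide. -/
theorem map_starProjection_stdGaussian (V : Submodule ℝ E) :
    (stdGaussian E).map V.orthogonalProjectionOnto = stdGaussian V := by
  have := Measure.isProbabilityMeasure_map (μ := stdGaussian E)
    V.orthogonalProjectionOnto.continuous.aemeasurable
  refine Measure.ext_of_charFun (funext fun t => ?_)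
  rw [charFun_stdGaussian, charFun_apply, integral_map (by fun_prop) (by fun_prop)]
  have : ∀ x : E, ⟪V.orthogonalProjectionOnto x, t⟫ = ⟪x, (t : E)⟫ := fun x => by
    simp
  simp_rw [this]
  rw [← charFun_apply, charFun_stdGaussian]
  simp

theorem map_norm_sq_starProjection_stdGaussian (V : Submodule ℝ E) (hV : 0 < Module.finrank ℝ V) :
    (stdGaussian E).map (fun x => ‖V.starProjection x‖ ^ 2) = chiSquared (Module.finrank ℝ V) := by
  rw [← map_norm_sq_stdGaussian hV, ← map_starProjection_stdGaussian, Measure.map_map]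
  · rfl
  · fun_prop
  · fun_prop

theorem map_inner_stdGaussian (r : E) :
    (stdGaussian E).map (fun x => ⟪r, x⟫) = (gaussianReal 0 1).map (‖r‖ * ·) := by
  have := Measure.isProbabilityMeasure_map (μ := stdGaussian E) (f := fun x => ⟪r, x⟫)
    (by fun_prop)
  rw [gaussianReal_map_const_mul]
  refine Measure.ext_of_charFun (funext fun t => ?_)
  rw [charFun_gaussianReal, charFun_apply_real, integral_map (by fun_prop) (by fun_prop)]
  have : ∀ x : E, (t * ⟪r, x⟫ : ℂ) = ⟪x, t • r⟫ := fun x => by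
    rw [real_inner_smul_right, real_inner_comm]; simp
  simp_rw [this]
  rw [← charFun_apply, charFun_stdGaussian, norm_smul, ← Complex.ofReal_pow, mul_pow,
    norm_eq_abs, sq_abs]
  simp only [NNReal.coe_mul, NNReal.coe_mk, NNReal.coe_one]
  congr 1
  push_cast
  ring

/-! ### Resampling one coordinate of a product measure -/

/-- This is how independence is used: coordinate `j` may be replaced by a fresh copy while the
others stay fixed. -/
theorem lintegral_pi_eq_lintegral_update {ι X : Type*} [Fintype ι] [DecidableEq ι]
    [MeasurableSpace X] (ν : Measure X) [IsProbabilityMeasure ν] {F : (ι → X) → ℝ≥0∞}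
    (hF : Measurable F) (j : ι) :
    ∫⁻ h, F h ∂Measure.pi (fun _ => ν) =
      ∫⁻ h, ∫⁻ x, F (Function.update h j x) ∂ν ∂Measure.pi (fun _ => ν) := by
  have hm : Measurable fun h : ι → X => ∫⁻ x, F (Function.update h j x) ∂ν := by
    exact Measurable.lintegral_prod_right' (f := fun p : (ι → X) × X => F (Function.update p.1 j p.2))
      (hF.comp measurable_update')
  refine lintegral_eq_of_lmarginal_eq {j} hF hm ?_
  ext h
  simp [lmarginal_singleton]

/-! ### Columns of a Gaussian matrix -/

/-- Transposing a matrix of independent variables with a common law preserves its law. -/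
theorem map_swap_pi {ι κ X : Type*} [Fintype ι] [Fintype κ] [MeasurableSpace X] (ν : Measure X)
    [IsProbabilityMeasure ν] :
    (Measure.pi fun _ : ι => Measure.pi fun _ : κ => ν).map (fun H j i => H i j) =
      Measure.pi fun _ : κ => Measure.pi fun _ : ι => ν := by
  have hm : Measurable fun (H : ι → κ → X) j i => H i j := by fun_prop
  symm
  refine Measure.pi_eq_generateFrom (C := fun _ => Set.pi univ '' Set.pi univ fun _ : ι =>
    {s : Set X | MeasurableSet s}) (fun _ => generateFrom_pi) (fun _ => isPiSystem_pi)
    (fun _ => ⟨fun _ => univ, fun _ => ⟨fun _ => univ, fun _ _ => MeasurableSet.univ, pi_univ _⟩,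
      by simp, iUnion_const _⟩) ?_
  intro s hs
  choose t ht hts using hs
  obtain rfl : (fun j => Set.pi univ (t j)) = s := funext hts
  have hpre : (fun (H : ι → κ → X) j i => H i j) ⁻¹' Set.pi univ (fun j => Set.pi univ (t j)) =
      Set.pi univ fun i => Set.pi univ fun j => t j i := by
    ext H
    simp only [mem_preimage, mem_univ_pi]
    exact forall_comm
  rw [Measure.map_apply hm, hpre, Measure.pi_pi]
  · simp_rw [Measure.pi_pi]
    exact Finset.prod_comm
  · exact MeasurableSet.univ_pi fun j => MeasurableSet.univ_pi fun i => ht j i trivial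

/-- The columns of a matrix, as vectors of a Euclidean space. -/
noncomputable def columns {m n : ℕ} (H : Fin m → Fin n → ℝ) (j : Fin n) :
    EuclideanSpace ℝ (Fin m) := WithLp.toLp 2 fun i => H i j

theorem measurable_columns {m n : ℕ} : Measurable (columns (m := m) (n := n)) := by
  refine measurable_pi_lambda _ fun j => ?_
  unfold columns
  fun_prop

theorem map_columns (m n : ℕ) :
    (Measure.pi fun _ : Fin m => Measure.pi fun _ : Fin n => gaussianReal 0 1).map columns =
      Measure.pi fun _ : Fin n => stdGaussian (EuclideanSpace ℝ (Fin m)) := by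
  simp_rw [← map_pi_eq_stdGaussian]
  rw [← Measure.pi_map_pi fun _ => by fun_prop, ← map_swap_pi (ι := Fin m) (κ := Fin n),
    Measure.map_map]
  · rfl
  · fun_prop
  · fun_prop

theorem gram_eq {m n : ℕ} (H : Fin m → Fin n → ℝ) :
    (Matrix.of H).transpose * Matrix.of H = Matrix.of fun i j => ⟪columns H i, columns H j⟫ := by
  ext i j
  simp [Matrix.mul_apply, columns, PiLp.inner_apply, mul_comm]

/-! ### The Gram–Schmidt process applied to independent Gaussian vectors -/

variable {n : ℕ}

/-- With vector `i` resampled, its Gram–Schmidt vector is a Gaussian projected onto a fixed nonzero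
subspace, and its squared norm is chi-squared, hence almost surely positive. -/
theorem ae_gramSchmidt_ne_zero (hn : n ≤ Module.finrank ℝ E) :
    ∀ᵐ h ∂Measure.pi (fun _ : Fin n => stdGaussian E), ∀ i, gramSchmidt ℝ h i ≠ 0 := by
  rw [ae_all_iff]
  intro i
  have hs : MeasurableSet {h : Fin n → E | ¬ gramSchmidt ℝ h i ≠ 0} := by
    simp only [not_not]
    exact measurable_gramSchmidt i (measurableSet_singleton 0)
  rw [ae_iff, ← lintegral_indicator_one hs,
    lintegral_pi_eq_lintegral_update _ (measurable_one.indicator hs) i]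
  refine lintegral_eq_zero_of_ae_eq_zero (ae_of_all _ fun h => ?_)
  refine lintegral_eq_zero_of_ae_eq_zero ?_
  have hV := finrank_orthogonal_span_pos hn h i
  have hpos : ∀ᵐ x ∂stdGaussian E,
      0 < ‖(Submodule.span ℝ (h '' Iio i))ᗮ.starProjection x‖ ^ 2 := by
    refine ae_of_ae_map (f := fun x => ‖(Submodule.span ℝ (h '' Iio i))ᗮ.starProjection x‖ ^ 2)
      (by fun_prop) (p := fun s => 0 < s) ?_
    rw [map_norm_sq_starProjection_stdGaussian _ hV]
    exact ae_pos_gammaMeasure _ _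
  refine hpos.mono fun x hx => indicator_of_notMem (fun h0 => ?_) _
  rw [mem_ofPred_eq, not_not, gramSchmidt_update_self] at h0
  simp [h0] at hx

/-- Given the other vectors, the law is chi-squared with the dimension of the complement as
parameter; this dimension is almost surely constant, so averaging changes nothing. -/
theorem map_norm_sq_gramSchmidt (hn : n ≤ Module.finrank ℝ E) (i : Fin n) :
    (Measure.pi fun _ : Fin n => stdGaussian E).map (fun h => ‖gramSchmidt ℝ h i‖ ^ 2) =
      chiSquared ((Module.finrank ℝ E : ℝ) - (i : ℕ)) := by
  have hm : Measurable fun h : Fin n → E => ‖gramSchmidt ℝ h i‖ ^ 2 :=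
    (measurable_gramSchmidt i).norm.pow_const 2
  ext B hB
  have hind : Measurable (B.indicator (1 : ℝ → ℝ≥0∞)) := measurable_one.indicator hB
  rw [← lintegral_indicator_one hB, lintegral_map hind hm,
    lintegral_pi_eq_lintegral_update _ (F := fun h => B.indicator 1 (‖gramSchmidt ℝ h i‖ ^ 2))
      (hind.comp hm) i, ← lintegral_indicator_one hB]
  have : ∀ᵐ h ∂Measure.pi (fun _ : Fin n => stdGaussian E),
      ∫⁻ x, B.indicator 1 (‖gramSchmidt ℝ (Function.update h i x) i‖ ^ 2) ∂stdGaussian E =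
        ∫⁻ s, B.indicator 1 s ∂chiSquared ((Module.finrank ℝ E : ℝ) - (i : ℕ)) := by
    refine (ae_gramSchmidt_ne_zero hn).mono fun h h0 => ?_
    have hV := finrank_orthogonal_span_pos hn h i
    have h1 := finrank_span_image_Iio h h0 i
    have h2 := Submodule.finrank_add_finrank_orthogonal (Submodule.span ℝ (h '' Iio i))
    have h3 : (Module.finrank ℝ E : ℝ) - (i : ℕ) =
        Module.finrank ℝ (Submodule.span ℝ (h '' Iio i))ᗮ := by
      rw [← h2, h1]; push_cast; ring
    rw [h3, ← map_norm_sq_starProjection_stdGaussian _ hV, lintegral_map hind (by fun_prop)]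
    simp_rw [gramSchmidt_update_self]
  rw [lintegral_congr_ae this]
  simp

/-- The joint law of the squared norm of a Gram–Schmidt vector and of its inner product with a
later vector. -/
theorem map_gramSchmidt_inner (hn : n ≤ Module.finrank ℝ E) {i j : Fin n} (hij : i < j) :
    (Measure.pi fun _ : Fin n => stdGaussian E).map
        (fun h => (‖gramSchmidt ℝ h i‖ ^ 2, ⟪gramSchmidt ℝ h i, h j⟫)) =
      ((chiSquared ((Module.finrank ℝ E : ℝ) - (i : ℕ))).prod (gaussianReal 0 1)).map
        (fun q => (q.1, √q.1 * q.2)) := by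
  have hg := measurable_gramSchmidt (E := E) i
  have hm : Measurable fun h : Fin n → E =>
      (‖gramSchmidt ℝ h i‖ ^ 2, ⟪gramSchmidt ℝ h i, h j⟫) :=
    (hg.norm.pow_const 2).prodMk (hg.inner (measurable_pi_apply j))
  have hq : Measurable fun q : ℝ × ℝ => (q.1, √q.1 * q.2) := by fun_prop
  ext B hB
  have hind : Measurable (B.indicator (1 : ℝ × ℝ → ℝ≥0∞)) := measurable_one.indicator hB
  have hG : Measurable fun s : ℝ => ∫⁻ g, B.indicator 1 (s, √s * g) ∂gaussianReal 0 1 :=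
    Measurable.lintegral_prod_right' (f := fun q : ℝ × ℝ => B.indicator 1 (q.1, √q.1 * q.2))
      (hind.comp hq)
  rw [← lintegral_indicator_one hB, lintegral_map hind hm,
    lintegral_pi_eq_lintegral_update _
      (F := fun h => B.indicator 1 (‖gramSchmidt ℝ h i‖ ^ 2, ⟪gramSchmidt ℝ h i, h j⟫))
      (hind.comp hm) j, ← lintegral_indicator_one hB,
    lintegral_map hind hq,
    lintegral_prod (fun q : ℝ × ℝ => B.indicator 1 (q.1, √q.1 * q.2)) (hind.comp hq).aemeasurable,
    ← map_norm_sq_gramSchmidt hn, lintegral_map hG (hg.norm.pow_const 2)]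
  -- Both sides are now integrals over `h`. Resampling `h j` leaves `gramSchmidt ℝ h i` fixed, and
  -- its inner product with a fresh Gaussian is normal with standard deviation `‖gramSchmidt ℝ h
  -- i‖`.
  refine lintegral_congr fun h => ?_
  simp only [gramSchmidt_update_of_lt h hij, Function.update_self, sqrt_sq (norm_nonneg _)]
  have hB' : Measurable fun z : ℝ =>
      B.indicator (1 : ℝ × ℝ → ℝ≥0∞) (‖gramSchmidt ℝ h i‖ ^ 2, z) :=
    hind.comp (by fun_prop)
  rw [← lintegral_map hB' (g := fun x => ⟪gramSchmidt ℝ h i, x⟫) (by fun_prop),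
    map_inner_stdGaussian, lintegral_map hB' (by fun_prop)]

end WishartLU

namespace WishartLU

open Set Real
open scoped RealInnerProductSpace
open InnerProductSpace

/-! ### The LU factors of a Wishart matrix -/

variable {n m : ℕ}

/-- The lower triangular factor produced by Gaussian elimination. -/
noncomputable def schurLower (A : Matrix (Fin n) (Fin n) ℝ) : Matrix (Fin n) (Fin n) ℝ :=
  Matrix.of fun i j => schur A j i j / schur A j j j

/-- The upper triangular factor produced by Gaussian elimination. -/
noncomputable def schurUpper (A : Matrix (Fin n) (Fin n) ℝ) : Matrix (Fin n) (Fin n) ℝ :=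
  Matrix.of fun i j => schur A i i j

theorem measurable_schurLower (i j : Fin n) :
    Measurable fun A : Matrix (Fin n) (Fin n) ℝ => schurLower A i j :=
  (measurable_schur j i j).div (measurable_schur j j j)

theorem measurable_schurUpper (i j : Fin n) :
    Measurable fun A : Matrix (Fin n) (Fin n) ℝ => schurUpper A i j :=
  measurable_schur i i j

theorem IsLU.eq_schur {A L U : Matrix (Fin n) (Fin n) ℝ} (h : IsLU A L U) (hA : A.det ≠ 0) :
    L = schurLower A ∧ U = schurUpper A :=
  ⟨Matrix.ext fun i j => h.lower_eq_schur (h.diag_ne_zero hA) i j,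
    Matrix.ext fun i j => h.upper_eq_schur (h.diag_ne_zero hA) i j⟩

theorem measurable_det (n : ℕ) : Measurable fun A : Matrix (Fin n) (Fin n) ℝ => A.det := by
  simp_rw [Matrix.det_apply]
  exact Finset.measurable_sum _ fun σ _ => Measurable.const_smul
    (Finset.measurable_prod _ fun i _ => measurable_schur 0 (σ i) i) _

/-- Measurability lets the almost sure factorization pass from `H` to the Wishart law, and from
there to any variable with that law. -/
theorem measurableSet_isLU_schur (n : ℕ) :
    MeasurableSet {A : Matrix (Fin n) (Fin n) ℝ |
      A.det ≠ 0 ∧ IsLU A (schurLower A) (schurUpper A)} := by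
  have hiff (A : Matrix (Fin n) (Fin n) ℝ) : IsLU A (schurLower A) (schurUpper A) ↔
      (∀ i, schurLower A i i = 1) ∧ (∀ i j, i < j → schurLower A i j = 0) ∧
      (∀ i j, j < i → schurUpper A i j = 0) ∧
      ∀ i j, schur A 0 i j = ∑ k, schurLower A i k * schurUpper A k j :=
    ⟨fun h => ⟨h.1, h.2, h.3, fun i j => congrFun (congrFun h.4 i) j⟩,
      fun h => ⟨h.1, h.2.1, h.2.2.1, Matrix.ext h.2.2.2⟩⟩
  simp_rw [hiff]
  refine measurableSet_setOfPred.2 (Measurable.and ?_ (Measurable.and ?_ (Measurable.and ?_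
    (Measurable.and ?_ ?_))))
  · exact measurableSet_setOfPred.1 (measurable_det n (measurableSet_singleton 0).compl)
  · exact Measurable.forall fun i => measurableSet_setOfPred.1
      (measurable_schurLower i i (measurableSet_singleton 1))
  · exact Measurable.forall fun i => Measurable.forall fun j => Measurable.imp measurable_const
      (measurableSet_setOfPred.1 (measurable_schurLower i j (measurableSet_singleton 0)))
  · exact Measurable.forall fun i => Measurable.forall fun j => Measurable.imp measurable_const
      (measurableSet_setOfPred.1 (measurable_schurUpper i j (measurableSet_singleton 0)))
  · exact Measurable.forall fun i => Measurable.forall fun j => measurableSet_setOfPred.1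
      (measurableSet_eq_fun (measurable_schur 0 i j) (Finset.measurable_sum _ fun k _ =>
        (measurable_schurLower i k).mul (measurable_schurUpper k j)))

/-- The factors of a Wishart matrix in terms of the Gram–Schmidt process. -/
theorem ae_isLU_gram (hmn : n ≤ m) :
    ∀ᵐ H ∂Measure.pi fun _ : Fin m => Measure.pi fun _ : Fin n => gaussianReal 0 1,
      ((Matrix.of H).transpose * Matrix.of H).det ≠ 0 ∧
      IsLU ((Matrix.of H).transpose * Matrix.of H)
        (schurLower ((Matrix.of H).transpose * Matrix.of H))
        (schurUpper ((Matrix.of H).transpose * Matrix.of H)) ∧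
      (∀ i j, schurLower ((Matrix.of H).transpose * Matrix.of H) i j =
        ⟪gramSchmidt ℝ (columns H) j, columns H i⟫ / ‖gramSchmidt ℝ (columns H) j‖ ^ 2) ∧
      (∀ i j, schurUpper ((Matrix.of H).transpose * Matrix.of H) i j =
        ⟪gramSchmidt ℝ (columns H) i, columns H j⟫) := by
  have h := ae_gramSchmidt_ne_zero (E := EuclideanSpace ℝ (Fin m)) (n := n) (by simpa using hmn)
  rw [← map_columns] at h
  refine (ae_of_ae_map measurable_columns.aemeasurable h).mono fun H h0 => ?_
  rw [gram_eq]
  have hdet := det_gram_ne_zero _ h0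
  have hLU := isLU_gram _ h0
  obtain ⟨hL, hU⟩ := hLU.eq_schur hdet
  rw [← hL, ← hU]
  exact ⟨hdet, hLU, fun i j => rfl, fun i j => rfl⟩

theorem ae_isLU_wishart (hmn : n ≤ m) :
    ∀ᵐ A ∂wishartMeasure n m, A.det ≠ 0 ∧ IsLU A (schurLower A) (schurUpper A) := by
  rw [wishartMeasure, ae_map_iff (measurable_gram n m).aemeasurable (measurableSet_isLU_schur n)]
  exact (ae_isLU_gram hmn).mono fun H h => ⟨h.1, h.2.1⟩

theorem hasLaw_columns (n m : ℕ) :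
    HasLaw (columns : (Fin m → Fin n → ℝ) → _)
      (Measure.pi fun _ => stdGaussian (EuclideanSpace ℝ (Fin m)))
      (Measure.pi fun _ => Measure.pi fun _ => gaussianReal 0 1) :=
  ⟨measurable_columns.aemeasurable, map_columns m n⟩

theorem hasLaw_schurUpper_diag (hmn : n ≤ m) (i : Fin n) :
    HasLaw (fun A => schurUpper A i i) (chiSquared ((m : ℝ) - (i : ℕ))) (wishartMeasure n m) := by
  have hlaw : HasLaw (fun h : Fin n → EuclideanSpace ℝ (Fin m) => ‖gramSchmidt ℝ h i‖ ^ 2)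
      (chiSquared ((m : ℝ) - (i : ℕ))) (Measure.pi fun _ => stdGaussian _) :=
    ⟨((measurable_gramSchmidt i).norm.pow_const 2).aemeasurable, by
      simpa using map_norm_sq_gramSchmidt (E := EuclideanSpace ℝ (Fin m)) (by simpa using hmn) i⟩
  have hcol := (hlaw.fun_comp (hasLaw_columns n m)).congr
    (Y := fun H => schurUpper ((Matrix.of H).transpose * Matrix.of H) i i)
    ((ae_isLU_gram hmn).mono fun H h => by
      simp only [h.2.2.2 i i, inner_gramSchmidt_self])
  refine ⟨(measurable_schurUpper i i).aemeasurable, ?_⟩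
  rw [← hcol.map_eq, wishartMeasure, Measure.map_map (measurable_schurUpper i i)
    (measurable_gram n m)]
  rfl

/-- The joint law of the squared norm of a Gram–Schmidt vector and of its inner product with a
later column of a Gaussian matrix. -/
theorem hasLaw_gramSchmidt_columns (hmn : n ≤ m) {i j : Fin n} (hij : i < j) :
    HasLaw (fun H : Fin m → Fin n → ℝ => (‖gramSchmidt ℝ (columns H) i‖ ^ 2,
        ⟪gramSchmidt ℝ (columns H) i, columns H j⟫))
      (((chiSquared ((m : ℝ) - (i : ℕ))).prod (gaussianReal 0 1)).map fun q => (q.1, √q.1 * q.2))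
      (Measure.pi fun _ => Measure.pi fun _ => gaussianReal 0 1) := by
  have hg := measurable_gramSchmidt (E := EuclideanSpace ℝ (Fin m)) i
  have hlaw : HasLaw (fun h : Fin n → EuclideanSpace ℝ (Fin m) =>
      (‖gramSchmidt ℝ h i‖ ^ 2, ⟪gramSchmidt ℝ h i, h j⟫))
      (((chiSquared ((m : ℝ) - (i : ℕ))).prod (gaussianReal 0 1)).map fun q => (q.1, √q.1 * q.2))
      (Measure.pi fun _ => stdGaussian _) :=
    ⟨((hg.norm.pow_const 2).prodMk (hg.inner (measurable_pi_apply j))).aemeasurable, by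
      simpa using map_gramSchmidt_inner (E := EuclideanSpace ℝ (Fin m)) (by simpa using hmn) hij⟩
  exact hlaw.fun_comp (hasLaw_columns n m)

theorem hasLaw_schurUpper (hmn : n ≤ m) {i j : Fin n} (hij : i < j) :
    HasLaw (fun A => schurUpper A i j)
      (volume.withDensity fun z => ENNReal.ofReal (offDiagPDF ((m : ℝ) - (i : ℕ)) z))
      (wishartMeasure n m) := by
  have hν : (1 : ℝ) < (m : ℝ) - (i : ℕ) := by
    have : (i : ℕ) + 1 < m := lt_of_le_of_lt (Nat.succ_le_of_lt (Fin.lt_def.1 hij))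
      (j.2.trans_le hmn)
    have : ((i : ℕ) : ℝ) + 1 < m := by exact_mod_cast this
    linarith
  have hq : Measurable fun q : ℝ × ℝ => (q.1, √q.1 * q.2) := by fun_prop
  have hsnd : HasLaw Prod.snd
      (volume.withDensity fun z => ENNReal.ofReal (offDiagPDF ((m : ℝ) - (i : ℕ)) z))
      (((chiSquared ((m : ℝ) - (i : ℕ))).prod (gaussianReal 0 1)).map
        fun q => (q.1, √q.1 * q.2)) :=
    ⟨measurable_snd.aemeasurable, by
      rw [Measure.map_map measurable_snd hq, ← map_sqrt_mul_eq_offDiag hν]; rfl⟩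
  have hcol := (hsnd.fun_comp (hasLaw_gramSchmidt_columns hmn hij)).congr
    (Y := fun H => schurUpper ((Matrix.of H).transpose * Matrix.of H) i j)
    ((ae_isLU_gram hmn).mono fun H h => h.2.2.2 i j)
  refine ⟨(measurable_schurUpper i j).aemeasurable, ?_⟩
  rw [← hcol.map_eq, wishartMeasure, Measure.map_map (measurable_schurUpper i j)
    (measurable_gram n m)]
  rfl

theorem hasLaw_schurLower (hmn : n ≤ m) {i j : Fin n} (hij : j < i) :
    HasLaw (fun A => √((m : ℝ) - (j : ℕ)) * schurLower A i j) (studentT ((m : ℝ) - (j : ℕ)))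
      (wishartMeasure n m) := by
  have hν : (0 : ℝ) < (m : ℝ) - (j : ℕ) := by
    have : ((j : ℕ) : ℝ) < m := by exact_mod_cast j.2.trans_le hmn
    linarith
  set ν : ℝ := (m : ℝ) - (j : ℕ)
  have hq : Measurable fun q : ℝ × ℝ => (q.1, √q.1 * q.2) := by fun_prop
  have hf : Measurable fun p : ℝ × ℝ => √ν * (p.2 / p.1) := by fun_prop
  have hdiv : HasLaw (fun p : ℝ × ℝ => √ν * (p.2 / p.1)) (studentT ν)
      (((chiSquared ν).prod (gaussianReal 0 1)).map fun q => (q.1, √q.1 * q.2)) := by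
    refine ⟨hf.aemeasurable, ?_⟩
    rw [Measure.map_map hf hq, ← map_sqrt_div_mul_eq_studentT hν]
    congr 1
    ext q
    simp only [Function.comp_apply]
    rw [mul_div_right_comm, sqrt_div_self', sqrt_div hν.le]
    ring
  have hm : Measurable fun A : Matrix (Fin n) (Fin n) ℝ => √ν * schurLower A i j :=
    (measurable_schurLower i j).const_mul _
  have hcol := (hdiv.fun_comp (hasLaw_gramSchmidt_columns hmn hij)).congr
    (Y := fun H => √ν * schurLower ((Matrix.of H).transpose * Matrix.of H) i j)
    ((ae_isLU_gram hmn).mono fun H h => by simp only [h.2.2.1 i j])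
  refine ⟨hm.aemeasurable, ?_⟩
  rw [← hcol.map_eq, wishartMeasure, Measure.map_map hm (measurable_gram n m)]
  rfl

end WishartLU

/-! ### Transfer to an arbitrary random matrix with the Wishart law. -/

theorem lemma6 {Ω : Type*} [MeasurableSpace Ω] (P : Measure Ω) [IsProbabilityMeasure P]
    (n m : ℕ) (hmn : n + 1 < m) (A : Ω → Matrix (Fin n) (Fin n) ℝ)
    (hA : HasLaw A (WishartLU.wishartMeasure n m) P) :
    -- almost surely, `A` has exactly one pair of LU factors
    (∀ᵐ ω ∂P, ∃! F : Matrix (Fin n) (Fin n) ℝ × Matrix (Fin n) (Fin n) ℝ,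
      WishartLU.IsLU (A ω) F.1 F.2) ∧
    ∀ L U : Ω → Matrix (Fin n) (Fin n) ℝ,
      (∀ᵐ ω ∂P, WishartLU.IsLU (A ω) (L ω) (U ω)) →
      -- indices are zero-based: the entry number `i` of the usual count is `i - 1` here
      (∀ i : Fin n, HasLaw (fun ω => U ω i i) (WishartLU.chiSquared ((m : ℝ) - (i : ℕ))) P) ∧
      (∀ i j : Fin n, i < j →
        HasLaw (fun ω => U ω i j)
          (volume.withDensity fun z =>
            ENNReal.ofReal (WishartLU.offDiagPDF ((m : ℝ) - (i : ℕ)) z)) P ∧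
        -- the value of the density at `0` is its limit there
        ContinuousAt (WishartLU.offDiagPDF ((m : ℝ) - (i : ℕ))) 0) ∧
      (∀ i j : Fin n, j < i →
        ∃ t : Ω → ℝ, HasLaw t (WishartLU.studentT ((m : ℝ) - (j : ℕ))) P ∧
          ∀ ω, L ω i j = 1 / Real.sqrt ((m : ℝ) - (j : ℕ)) * t ω) := by
  have hnm : n ≤ m := by omega
  have hgood : ∀ᵐ ω ∂P, (A ω).det ≠ 0 ∧
      WishartLU.IsLU (A ω) (WishartLU.schurLower (A ω)) (WishartLU.schurUpper (A ω)) :=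
    (hA.ae_iff (measurableSet_setOfPred.1 (WishartLU.measurableSet_isLU_schur n))).2
      (WishartLU.ae_isLU_wishart hnm)
  refine ⟨hgood.mono fun ω h => h.2.existsUnique h.1, fun L U hLU => ?_⟩
  -- `L` and `U` are not assumed measurable; almost sure equality with the Schur factors supplies
  -- both a.e. measurability and the laws.
  have heq : ∀ᵐ ω ∂P, L ω = WishartLU.schurLower (A ω) ∧ U ω = WishartLU.schurUpper (A ω) := by
    filter_upwards [hgood, hLU] with ω h1 h2 using h2.eq_schur h1.1
  refine ⟨fun i => ?_, fun i j hij => ⟨?_, ?_⟩, fun i j hij => ?_⟩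
  · exact ((WishartLU.hasLaw_schurUpper_diag hnm i).fun_comp hA).congr
      (heq.mono fun ω h => by simp only [h.2])
  · exact ((WishartLU.hasLaw_schurUpper hnm hij).fun_comp hA).congr
      (heq.mono fun ω h => by simp only [h.2])
  · refine WishartLU.continuousAt_offDiagPDF ?_
    have : ((i : ℕ) : ℝ) + 1 < m := by
      have := i.2
      exact_mod_cast (by omega : (i : ℕ) + 1 < m)
    linarith
  · have hν : (0 : ℝ) < (m : ℝ) - (j : ℕ) := by
      have : ((j : ℕ) : ℝ) < m := by exact_mod_cast j.2.trans_le hnm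
      linarith
    -- Defining `t` from `L` itself makes the required identity hold at every `ω`, not only almost
    -- surely.
    refine ⟨fun ω => √((m : ℝ) - (j : ℕ)) * L ω i j,
      ((WishartLU.hasLaw_schurLower hnm hij).fun_comp hA).congr
        (heq.mono fun ω h => by simp only [h.1]), fun ω => ?_⟩
    have := Real.sqrt_pos.2 hν
    field_simp
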